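/- Conventions. A linear code $\mathcal{C}\subseteq\mathbb{F}^n$ is an $[n,k,d]$ code if it has dimension $k$ and minimum Hamming distance $d$. For $1\le r\le k$ and $\delta\ge 2$, an $(r,\delta)$-repair set of $\mathcal{C}$ is a set $A$ of coordinates with $|A|\le r+\delta-1$ such that for every $l\in A$ and every $L\subseteq A\setminus\{l\}$ with $|L|=\max\{|A|-(\delta-1),0\}$, the symbol $c_l$ is a linear function of the symbols $c_i$, $i\in L$, for $c\in\mathcal{C}$. The code has $(r,\delta)_a$-locality if every coordinate lies in an $(r,\delta)$-repair set. A set $S$ in an extension field of $\mathbb{F}_q$ is $t$-wise independent over $\mathbb{F}_q$ if every $T\subseteq S$ with $|T|\le t$ is linearly independent over $\mathbb{F}_q$. Theorem. Let $n=w(r+\delta-1)+m$ and $k=ur+v$, where $w,u,r,v,\delta,m$ are nonnegative integers with $0<m\le\delta-1$, $r>v>\lfloor r/2\rfloor$ and $u\ge 2r+\delta-1$, and assume that $h=n-k-m-w(\delta-1)\ge 0$. Let $\mathbb{F}_q\subseteq\mathbb{F}_{q_1}$ be finite fields, let $P_1$ be an $(m+\delta-1)\times(m+r+\delta-1)$ parity-check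 matrix of an $[m+r+\delta-1,r,m+\delta]$ MDS code over $\mathbb{F}_q$, and let $P_2$ be a $(\delta-1)\times(r+\delta-1)$ parity-check matrix of an $[r+\delta-1,r,\delta]$ MDS code over $\mathbb{F}_q$. Let $S=\{\alpha_1,\dots,\alpha_n\}\subseteq\mathbb{F}_{q_1}$ be a set of $n$ elements, enumerated in any order, that is $(h+(w+1-u)(\delta-1))$-wise independent over $\mathbb{F}_q$. Let $\mathcal{C}(S,h)\subseteq\mathbb{F}_{q_1}^n$ be the code with parity-check matrix $$\begin{pmatrix}P_1&0&\cdots&0\\0&P_2&\cdots&0\\\vdots&\vdots&\ddots&\vdots\\0&0&\cdots&P_2\\H_1&H_2&\cdots&H_w\end{pmatrix},\qquad (H_1,\dots,H_w)=\bigl(\alpha_j^{q^{i}}\bigr)_{0\le i\le h-1,\ 1\le j\le n},$$ with one block $P_1$ and $w-1$ blocks $P_2$. Then $\mathcal{C}(S,h)$ is an $[n,k,d]$ code over $\mathbb{F}_{q_1}$ with $(r,\delta)_a$-locality and $d=h+(w-u)(\delta-1)+1$, and it is optimal: $$d=n-k+1-\left\lceil\frac{k}{r}\right\rceil(\delta-1)+(\delta-1-m),$$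 and the right-hand side is an upper bound on the minimum distance of every linear code of length $n$ and dimension $k$ with $(r,\delta)_a$-locality over any finite field. -/

import Mathlib

/-- The linear code with parity-check matrix `H`: all vectors `c` with `H c = 0`. -/
def parityCheckCode {ρ ι K : Type*} [Fintype ι] [Field K] (H : Matrix ρ ι K) :
    Submodule K (ι → K) :=
  LinearMap.ker H.mulVecLin

open Classical in
/-- `C` is a linear `[n, k, d]` code: its length is `n`, its dimension is `k`, and its minimum
Hamming distance (the least distance between two distinct codewords) is `d`. -/
def IsLinearCodeWithParams {ι K : Type*} [Fintype ι] [Field K] (C : Submodule K (ι → K))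
    (n k d : ℕ) : Prop :=
  Fintype.card ι = n ∧ Module.finrank K C = k ∧
    IsLeast {e : ℕ | ∃ x ∈ C, ∃ y ∈ C, x ≠ y ∧ hammingDist x y = e} d

/-- `A` is an `(r, δ)`-repair set of `C`: it has at most `r + δ - 1` elements, and for every `l ∈ A`
and every `L ⊆ A \ {l}` with `|L| = |A| - (δ - 1)` the symbol `c_l` is a linear function of the
symbols `c_i`, `i ∈ L`, for `c ∈ C`.

If `|A| < δ - 1` the truncated difference makes `L` empty, so that all symbols in `A` vanish. This
is what the equivalent condition `d(C_A) ≥ δ` on the punctured code says for such a set. -/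
def IsRepairSet {ι K : Type*} [Field K] (C : Submodule K (ι → K)) (r δ : ℕ)
    (A : Finset ι) : Prop :=
  A.card ≤ r + δ - 1 ∧
    ∀ l ∈ A, ∀ L : Finset ι, L ⊆ A → l ∉ L → L.card = A.card - (δ - 1) →
      ∃ a : ι → K, ∀ c ∈ C, c l = ∑ i ∈ L, a i * c i

/-- `C` has `(r, δ)_a`-locality (all-symbol locality), where `1 ≤ r ≤ dim C` and `δ ≥ 2`: every
coordinate lies in an `(r, δ)`-repair set. -/
def HasAllSymbolLocality {ι K : Type*} [Field K] (C : Submodule K (ι → K)) (r δ : ℕ) : Prop :=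
  1 ≤ r ∧ r ≤ Module.finrank K C ∧ 2 ≤ δ ∧
    ∀ i : ι, ∃ A : Finset ι, IsRepairSet C r δ A ∧ i ∈ A

/-- `S ⊆ L` is `t`-wise independent over `F`: every `T ⊆ S` with `|T| ≤ t` is linearly independent
over `F`. -/
def IsWiseIndependent (F : Type*) {L : Type*} [Field F] [Field L] [Algebra F L]
    (S : Set L) (t : ℕ) : Prop :=
  ∀ T : Finset L, (T : Set L) ⊆ S → T.card ≤ t → LinearIndependent F (fun x : T => (x : L))

/-- The Moore matrix with rows `α, α^q, …, α^(q^(h-1))`. -/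
def mooreMatrix {ι L : Type*} [Field L] (q h : ℕ) (α : ι → L) : Matrix (Fin h) ι L :=
  Matrix.of fun i j => α j ^ q ^ (i : ℕ)

/-- The coordinates of the code: one block of size `m + r + δ - 1`, followed by `w - 1` blocks of
size `r + δ - 1` (the pair `(x, j)` is position `x` of the `j`-th of these blocks). -/
abbrev BlockCoord (w r δ m : ℕ) : Type :=
  Fin (m + r + δ - 1) ⊕ (Fin (r + δ - 1) × Fin (w - 1))

/-- The parity-check matrix
```
  P₁  0   …  0
  0   P₂  …  0
  ⋮       ⋱
  0   0   …  P₂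
  H₁  H₂  …  H_w
```
with one block `P₁`, with `w - 1` blocks `P₂`, and with `(H₁, …, H_w)` the `h`-row Moore matrix
of `α`, where `q = |F|`. -/
def blockParityCheck {F L : Type*} [Field F] [Fintype F] [Field L] [Algebra F L]
    {w r δ m : ℕ} (h : ℕ)
    (P₁ : Matrix (Fin (m + δ - 1)) (Fin (m + r + δ - 1)) F)
    (P₂ : Matrix (Fin (δ - 1)) (Fin (r + δ - 1)) F)
    (α : BlockCoord w r δ m → L) :
    Matrix ((Fin (m + δ - 1) ⊕ (Fin (δ - 1) × Fin (w - 1))) ⊕ Fin h) (BlockCoord w r δ m) L :=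
  Matrix.fromRows
    (Matrix.fromBlocks (P₁.map (algebraMap F L)) 0 0
      (Matrix.blockDiagonal fun _ : Fin (w - 1) => P₂.map (algebraMap F L)))
    (mooreMatrix (Fintype.card F) h α)

/-- The value `n - k + 1 - ⌈k / r⌉ (δ - 1) + (δ - 1 - m)` of the upper bound on the minimum
distance. -/
def distanceBound (n k r δ m : ℕ) : ℤ :=
  (n : ℤ) - k + 1 - ⌈(k : ℚ) / r⌉ * ((δ : ℤ) - 1) + ((δ : ℤ) - 1 - m)

/-! Call `dim C - dim (shortening C T)` the rank of `T`, and `|T|` minus the rank its nullity. A set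
of rank below `k` and nullity `ν` forces `d ≤ n - k + 1 - ν` (`minDist_add_card_le`), so the upper
bound needs rank at most `u * r` and nullity at least `u * (δ - 1) + m`. A repair set outside the
closure adds at most `r` to the rank and at least `δ - 1` to the nullity, so chains of repair sets
supply everything but the `m`. If the bound fails, the closure of a chain of length at most `u`
contains fewer than `m` new coordinates, and chains fall short of full size by at most `r - v`. A
chain with maximal shortage, built from at most two sets per unit, makes the remaining repair sets
full and essentially disjoint (`exists_isRepairChain_saturated`). Since `n ≡ m` modulo `r + δ - 1`,
a maximal disjoint family of them leaves at least `m` coordinates uncovered; any `m` of these are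
determined by the chain and at most `m` members of the family, a contradiction.

For the code itself, a word of small support is treated by using the local checks to eliminate up to
`δ - 1` symbols per block (`m + δ - 1` in the first). At most `h` symbols remain, and they satisfy a
Moore system whose entries are again independent over the base field (`eq_zero_of_mulVec_of_moore`),
so the word is zero. This bounds the distance from below and the dimension from above; counting rows
bounds the dimension from below, and the upper bound on the distance applies to the code itself. -/

/-! ### Rank, nullity and closure of coordinate sets. -/

/-- The codewords of `C` that vanish on `T`. -/
def shortening {ι K : Type*} [Field K] (C : Submodule K (ι → K)) (T : Finset ι) :
    Submodule K (ι → K) :=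
  C ⊓ LinearMap.ker (LinearMap.funLeft K K (fun i : T => (i : ι)))

theorem mem_shortening {ι K : Type*} [Field K] {C : Submodule K (ι → K)} {T : Finset ι}
    {c : ι → K} : c ∈ shortening C T ↔ c ∈ C ∧ ∀ i ∈ T, c i = 0 := by
  simp [shortening, funext_iff, LinearMap.funLeft]

open Classical in
/-- The coordinates on which every codeword vanishing on `T` vanishes. -/
noncomputable def coordClosure {ι K : Type*} [Fintype ι] [Field K] (C : Submodule K (ι → K))
    (T : Finset ι) : Finset ι :=
  Finset.univ.filter fun i => ∀ c ∈ shortening C T, c i = 0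

theorem mem_coordClosure {ι K : Type*} [Fintype ι] [Field K] {C : Submodule K (ι → K)}
    {T : Finset ι} {i : ι} : i ∈ coordClosure C T ↔ ∀ c ∈ shortening C T, c i = 0 := by
  simp [coordClosure]

section Closure

variable {ι K : Type*} [Field K] {C : Submodule K (ι → K)}

theorem shortening_anti {S T : Finset ι} (h : S ⊆ T) : shortening C T ≤ shortening C S := by
  intro c hc
  rw [mem_shortening] at hc ⊢
  exact ⟨hc.1, fun i hi => hc.2 i (h hi)⟩

theorem shortening_empty : shortening C ∅ = C := by
  ext c
  simp [mem_shortening]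

variable [Fintype ι]

theorem subset_coordClosure (T : Finset ι) : T ⊆ coordClosure C T := by
  intro i hi
  rw [mem_coordClosure]
  exact fun c hc => (mem_shortening.1 hc).2 i hi

theorem coordClosure_mono {S T : Finset ι} (h : S ⊆ T) : coordClosure C S ⊆ coordClosure C T := by
  intro i hi
  rw [mem_coordClosure] at hi ⊢
  exact fun c hc => hi c (shortening_anti h hc)

theorem shortening_eq_of_subset_coordClosure {S T : Finset ι} (h : S ⊆ T)
    (h' : T ⊆ coordClosure C S) : shortening C T = shortening C S := by
  refine le_antisymm (shortening_anti h) fun c hc => ?_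
  exact mem_shortening.2 ⟨(mem_shortening.1 hc).1, fun i hi => mem_coordClosure.1 (h' hi) c hc⟩

theorem shortening_coordClosure (T : Finset ι) :
    shortening C (coordClosure C T) = shortening C T :=
  shortening_eq_of_subset_coordClosure (subset_coordClosure T) subset_rfl

theorem finrank_shortening_le_union [DecidableEq ι] (S T : Finset ι) :
    Module.finrank K (shortening C S) ≤
      Module.finrank K (shortening C (S ∪ T)) + (T \ S).card := by
  set f : (ι → K) →ₗ[K] ((T \ S : Finset ι) → K) :=
    LinearMap.funLeft K K (fun i : (T \ S : Finset ι) => (i : ι)) with hf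
  have h1 : shortening C (S ∪ T) = shortening C S ⊓ LinearMap.ker f := by
    ext c
    rw [Submodule.mem_inf, mem_shortening, mem_shortening, and_assoc]
    refine and_congr_right fun _ => ?_
    simp only [hf, LinearMap.mem_ker, funext_iff, LinearMap.funLeft_apply, Pi.zero_apply,
      Subtype.forall, Finset.mem_union, Finset.mem_sdiff]
    constructor
    · exact fun h => ⟨fun i hi => h i (Or.inl hi), fun i hi => h i (Or.inr hi.1)⟩
    · rintro ⟨h, h'⟩ i hi
      by_cases hS : i ∈ S
      · exact h i hS
      · exact h' i ⟨hi.resolve_left hS, hS⟩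
  have h2 := Submodule.finrank_sup_add_finrank_inf_eq (shortening C S) (LinearMap.ker f)
  have h3 := LinearMap.finrank_range_add_finrank_ker f
  have h4 : Module.finrank K (LinearMap.range f) ≤ (T \ S).card := by
    refine (Submodule.finrank_le _).trans ?_
    rw [Module.finrank_fintype_fun_eq_card, Fintype.card_coe]
  have h5 := Submodule.finrank_le (shortening C S ⊔ LinearMap.ker f)
  rw [h1]
  omega

theorem finrank_shortening_univ :
    Module.finrank K (shortening C (Finset.univ : Finset ι)) = 0 := by
  have : shortening C (Finset.univ : Finset ι) = ⊥ := by
    rw [eq_bot_iff]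
    intro c hc
    rw [Submodule.mem_bot]
    ext i
    exact (mem_shortening.1 hc).2 i (Finset.mem_univ i)
  rw [this, finrank_bot]

theorem exists_notMem_coordClosure {T : Finset ι}
    (hT : 0 < Module.finrank K (shortening C T)) : ∃ i, i ∉ coordClosure C T := by
  by_contra! h
  have : coordClosure C T = Finset.univ := Finset.eq_univ_iff_forall.2 h
  rw [← shortening_coordClosure, this, finrank_shortening_univ] at hT
  exact lt_irrefl _ hT

/-- A set of coordinates that does not determine all codewords bounds the minimum distance. -/
theorem minDist_add_card_le [DecidableEq K] {d : ℕ}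
    (hd : ∀ c ∈ C, c ≠ 0 → d ≤ hammingNorm c) :
    ∀ (N : ℕ) (T : Finset ι), Module.finrank K (shortening C T) = N + 1 →
      d + T.card + N ≤ Fintype.card ι := by
  classical
  intro N
  induction N with
  | zero =>
    intro T hT
    have hne : shortening C T ≠ ⊥ := by
      intro h
      rw [h, finrank_bot] at hT
      omega
    obtain ⟨c, hc, hc0⟩ := Submodule.exists_mem_ne_zero_of_ne_bot hne
    rw [mem_shortening] at hc
    have h1 := hd c hc.1 hc0
    have h2 : hammingNorm c ≤ (Finset.univ \ T).card := by
      refine Finset.card_le_card fun i hi => ?_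
      simp only [Finset.mem_filter, Finset.mem_univ, true_and] at hi
      simpa using fun hiT => hi (hc.2 i hiT)
    have h3 := Finset.card_sdiff_add_card_eq_card (Finset.subset_univ T)
    rw [Finset.card_univ] at h3
    omega
  | succ N ih =>
    intro T hT
    have hlt : ∃ i, i ∉ coordClosure C T := exists_notMem_coordClosure (by omega)
    obtain ⟨i, hi⟩ := hlt
    have hiT : i ∉ T := fun h => hi (subset_coordClosure T h)
    have h1 := finrank_shortening_le_union (C := C) T {i}
    have h2 : ({i} \ T : Finset ι).card ≤ 1 := by
      simpa using Finset.card_le_card (Finset.sdiff_subset (s := {i}) (t := T))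
    -- A coordinate outside the closure lowers the dimension by exactly one, so `T` grows until the
    -- shortening is a line, whose nonzero words are supported off `T`.
    have h3 : Module.finrank K (shortening C (T ∪ {i})) < Module.finrank K (shortening C T) := by
      refine Submodule.finrank_lt_finrank_of_lt
        (lt_of_le_of_ne (shortening_anti Finset.subset_union_left) fun h => hi ?_)
      rw [mem_coordClosure]
      intro c hc
      rw [← h] at hc
      exact (mem_shortening.1 hc).2 i (by simp)
    have h4 := ih (T ∪ {i}) (by omega)
    rw [Finset.card_union_of_disjoint (by simpa using hiT), Finset.card_singleton] at h4
    omega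

theorem IsRepairSet.subset_coordClosure [DecidableEq ι]
    {r δ : ℕ} {A T : Finset ι} (hA : IsRepairSet C r δ A)
    (h : A.card - (δ - 1) ≤ (A ∩ T).card) : A ⊆ coordClosure C T := by
  obtain ⟨L, hL, hLc⟩ := Finset.exists_subset_card_eq h
  intro l hl
  by_cases hlL : l ∈ L
  · exact _root_.subset_coordClosure T (Finset.mem_inter.1 (hL hlL)).2
  obtain ⟨a, ha⟩ := hA.2 l hl L (hL.trans Finset.inter_subset_left) hlL hLc
  rw [mem_coordClosure]
  intro c hc
  rw [mem_shortening] at hc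
  rw [ha c hc.1]
  exact Finset.sum_eq_zero fun i hi => by rw [hc.2 i (Finset.mem_inter.1 (hL hi)).2, mul_zero]

/-- In terms of rank and nullity: adjoining `A` raises the rank by at most `r` and the nullity by at
least `δ - 1`. -/
theorem IsRepairSet.finrank_shortening_union [DecidableEq ι]
    {r δ : ℕ} (hδ : 1 ≤ δ) {A T : Finset ι}
    (hA : IsRepairSet C r δ A) (h : ¬ A ⊆ coordClosure C T) :
    Module.finrank K (shortening C T) + (δ - 1) ≤
        Module.finrank K (shortening C (T ∪ A)) + (A \ T).card ∧
      Module.finrank K (shortening C T) ≤ Module.finrank K (shortening C (T ∪ A)) + r := by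
  have h1 : (A ∩ T).card < A.card - (δ - 1) := by
    by_contra! h'
    exact h (hA.subset_coordClosure h')
  -- `L` contains `A ∩ T` and determines `A`. Hence only `L \ T` contributes to the rank, while `A \
  -- T` has `δ - 1` further elements.
  obtain ⟨L, hTL, hLA, hLc⟩ := Finset.exists_subsuperset_card_eq
    (Finset.inter_subset_left (s₁ := A) (s₂ := T)) h1.le (Nat.sub_le _ _)
  have h2 : A ⊆ coordClosure C L :=
    hA.subset_coordClosure (by rw [Finset.inter_eq_right.2 hLA, hLc])
  have h3 : shortening C (T ∪ A) = shortening C (T ∪ L) :=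
    shortening_eq_of_subset_coordClosure (Finset.union_subset_union_right hLA)
      (Finset.union_subset (Finset.subset_union_left.trans (_root_.subset_coordClosure _))
        (h2.trans (coordClosure_mono Finset.subset_union_right)))
  have h4 := finrank_shortening_le_union (C := C) T L
  rw [h3]
  have h5 : (L \ T).card + (A ∩ T).card = L.card := by
    rw [← Finset.card_sdiff_add_card_inter L T]
    congr 2
    ext i
    simp only [Finset.mem_inter]
    exact ⟨fun hi => ⟨hTL (Finset.mem_inter.2 hi), hi.2⟩, fun hi => ⟨hLA hi.1, hi.2⟩⟩
  have h6 := Finset.card_sdiff_add_card_inter A T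
  have h7 := hA.1
  omega

end Closure

theorem card_union_eq_card_add_card_sdiff {ι : Type*} [DecidableEq ι] (S T : Finset ι) :
    (S ∪ T).card = S.card + (T \ S).card := by
  rw [← Finset.union_sdiff_self_eq_union, Finset.card_union_of_disjoint Finset.disjoint_sdiff]

/-! ### The upper bound on the minimum distance. -/

section Bound

variable {ι K : Type*} [Fintype ι] [Field K] {C : Submodule K (ι → K)}

theorem exists_isRepairSet_not_subset_coordClosure {r δ : ℕ}
    (hloc : ∀ i : ι, ∃ A : Finset ι, IsRepairSet C r δ A ∧ i ∈ A) {T : Finset ι}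
    (hT : 0 < Module.finrank K (shortening C T)) :
    ∃ A : Finset ι, IsRepairSet C r δ A ∧ ¬ A ⊆ coordClosure C T := by
  obtain ⟨i, hi⟩ := exists_notMem_coordClosure hT
  obtain ⟨A, hA, hiA⟩ := hloc i
  exact ⟨A, hA, fun h => hi (h hiA)⟩

/-- A set of rank at most `j * r` and nullity at least `j * (δ - 1) + e`, with `j ≤ u`, bounds the
minimum distance of a code of dimension `u * r + v`, `v > 0`, all of whose coordinates lie in
repair sets. -/
theorem minDist_add_le_of_nullity [DecidableEq K] {r δ u v d e : ℕ} (hδ : 1 ≤ δ)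
    (hloc : ∀ i : ι, ∃ A : Finset ι, IsRepairSet C r δ A ∧ i ∈ A) (hv : 0 < v)
    (hd : ∀ c ∈ C, c ≠ 0 → d ≤ hammingNorm c) (t : ℕ) :
    ∀ (j : ℕ) (T : Finset ι), j + t = u →
      u * r + v ≤ Module.finrank K (shortening C T) + j * r →
      u * r + v + j * (δ - 1) + e ≤ T.card + Module.finrank K (shortening C T) →
      d + (u * r + v) + u * (δ - 1) + e ≤ Fintype.card ι + 1 := by
  classical
  induction t with
  | zero =>
    intro j T hj h1 h2
    obtain rfl : j = u := by omega
    have h3 := minDist_add_card_le hd (Module.finrank K (shortening C T) - 1) T (by omega)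
    omega
  | succ t ih =>
    intro j T hj h1 h2
    have hju : j * r ≤ u * r := Nat.mul_le_mul_right _ (by omega)
    obtain ⟨A, hA, hAT⟩ := exists_isRepairSet_not_subset_coordClosure hloc (T := T) (by omega)
    obtain ⟨h3, h4⟩ := hA.finrank_shortening_union hδ hAT
    have h5 := card_union_eq_card_add_card_sdiff T A
    refine ih (j + 1) (T ∪ A) (by omega) ?_ ?_
    · rw [add_one_mul]; omega
    · rw [add_one_mul]; omega

/-- The numerical properties of a union `T` of `j` repair sets, none of which is determined by the
previous ones, in a code of dimension `k`. -/
structure IsRepairChain (C : Submodule K (ι → K)) (k r δ j : ℕ) (T : Finset ι) : Prop where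
  le_rank : k ≤ Module.finrank K (shortening C T) + j * r
  le_nullity : k + j * (δ - 1) ≤ T.card + Module.finrank K (shortening C T)
  card_le : T.card ≤ j * (r + (δ - 1))

theorem IsRepairChain.union [DecidableEq ι]
    {k r δ j : ℕ} {T A : Finset ι} (hT : IsRepairChain C k r δ j T)
    (hδ : 1 ≤ δ) (hA : IsRepairSet C r δ A) (hAT : ¬ A ⊆ coordClosure C T) :
    IsRepairChain C k r δ (j + 1) (T ∪ A) := by
  obtain ⟨h1, h2, h3⟩ := hT
  obtain ⟨h4, h5⟩ := hA.finrank_shortening_union hδ hAT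
  have h6 := card_union_eq_card_add_card_sdiff T A
  have h7 := Finset.card_le_card (Finset.sdiff_subset (s := A) (t := T))
  have h8 := hA.1
  refine ⟨?_, ?_, ?_⟩ <;> rw [add_one_mul] <;> omega

/-- Passing to the closure keeps the rank, so every new coordinate is extra nullity; `m` of them
would contradict `hlarge`. -/
theorem IsRepairChain.card_coordClosure_sdiff_lt [DecidableEq ι] [DecidableEq K]
    {r δ u v d m j : ℕ} {T : Finset ι}
    (hT : IsRepairChain C (u * r + v) r δ j T) (hδ : 1 ≤ δ)
    (hloc : ∀ i : ι, ∃ A : Finset ι, IsRepairSet C r δ A ∧ i ∈ A) (hv : 0 < v)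
    (hd : ∀ c ∈ C, c ≠ 0 → d ≤ hammingNorm c)
    (hlarge : Fintype.card ι + 1 < d + (u * r + v) + u * (δ - 1) + m) (hj : j ≤ u) :
    (coordClosure C T \ T).card < m := by
  by_contra! h
  have h1 := card_union_eq_card_add_card_sdiff T (coordClosure C T)
  rw [Finset.union_eq_right.2 (subset_coordClosure T)] at h1
  have h2 := minDist_add_le_of_nullity (u := u) (v := v) (e := m) hδ hloc hv hd (u - j) j
    (coordClosure C T) (by omega) (by rw [shortening_coordClosure]; exact hT.le_rank)
    (by rw [shortening_coordClosure]; have := hT.le_nullity; omega)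
  omega

/-- The shortage `j * (r + (δ - 1)) - |T|` never decreases when a chain is extended, so it suffices
to bound it at length `u + 1`. -/
theorem IsRepairChain.defect_le [DecidableEq K] {r δ u v d m : ℕ} (hδ : 1 ≤ δ)
    (hloc : ∀ i : ι, ∃ A : Finset ι, IsRepairSet C r δ A ∧ i ∈ A) (hv : 0 < v)
    (hd : ∀ c ∈ C, c ≠ 0 → d ≤ hammingNorm c) (hmδ : m ≤ δ - 1)
    (hlarge : Fintype.card ι + 1 < d + (u * r + v) + u * (δ - 1) + m) (t : ℕ) :
    ∀ (j : ℕ) (T : Finset ι), j + t = u + 1 → IsRepairChain C (u * r + v) r δ j T →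
      j * (r + (δ - 1)) + v ≤ T.card + r := by
  classical
  induction t with
  | zero =>
    intro j T hj hT
    obtain rfl : j = u + 1 := by omega
    have h1 := hT.le_nullity
    rw [add_one_mul] at h1 ⊢
    rw [mul_add]
    -- At full rank the nullity bound gives the required size of `T`. Below full rank the nullity
    -- `(u + 1) * (δ - 1) ≥ u * (δ - 1) + m` contradicts `hlarge`.
    rcases Nat.eq_zero_or_pos (Module.finrank K (shortening C T)) with h0 | h0
    · omega
    · have h3 := minDist_add_card_le hd (Module.finrank K (shortening C T) - 1) T (by omega)
      omega
  | succ t ih =>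
    intro j T hj hT
    have h1 := hT.le_rank
    have hju : j * r ≤ u * r := Nat.mul_le_mul_right _ (by omega)
    obtain ⟨A, hA, hAT⟩ := exists_isRepairSet_not_subset_coordClosure hloc (T := T) (by omega)
    have h2 := ih (j + 1) (T ∪ A) (by omega) (hT.union hδ hA hAT)
    have h3 := Finset.card_union_le T A
    have h4 := hA.1
    rw [add_one_mul] at h2
    omega

/-- A chain of repair sets, short compared with its defect, such that all repair sets that are
not determined by it have full size and are disjoint from it and from each other unless
they determine each other. -/
theorem exists_isRepairChain_saturated [DecidableEq ι] [DecidableEq K]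
    {r δ u v d m : ℕ} (hδ : 1 ≤ δ)
    (hloc : ∀ i : ι, ∃ A : Finset ι, IsRepairSet C r δ A ∧ i ∈ A) (hv : 0 < v)
    (hd : ∀ c ∈ C, c ≠ 0 → d ≤ hammingNorm c) (hmδ : m ≤ δ - 1)
    (hlarge : Fintype.card ι + 1 < d + (u * r + v) + u * (δ - 1) + m)
    (hk : Module.finrank K C = u * r + v) (hu : 2 * (r - v) + 2 ≤ u) :
    ∃ (j D : ℕ) (T : Finset ι), IsRepairChain C (u * r + v) r δ j T ∧ j ≤ 2 * D ∧ D ≤ r - v ∧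
      D + T.card = j * (r + (δ - 1)) ∧
      (∀ B, IsRepairSet C r δ B → ¬ B ⊆ coordClosure C T →
        B.card = r + (δ - 1) ∧ Disjoint T B) ∧
      ∀ B B', IsRepairSet C r δ B → IsRepairSet C r δ B' → ¬ B ⊆ coordClosure C T →
        ¬ B' ⊆ coordClosure C (T ∪ B) → Disjoint B B' := by
  classical
  -- `D` is the shortage of the chain. The budget `j ≤ 2 * D` allows one or two more sets whenever
  -- they raise `D`, and with `D ≤ r - v` it keeps `j + 2 ≤ u`.
  set Q : ℕ → Prop := fun D => ∃ (j : ℕ) (T : Finset ι), IsRepairChain C (u * r + v) r δ j T ∧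
    j ≤ u ∧ j ≤ 2 * D ∧ D + T.card = j * (r + (δ - 1)) with hQ
  have hbound : ∀ D, Q D → D ≤ r - v := by
    rintro D ⟨j, T, hT, hj, -, hD⟩
    have := IsRepairChain.defect_le hδ hloc hv hd hmδ hlarge (u + 1 - j) j T (by omega) hT
    omega
  have hQ0 : Q 0 := by
    refine ⟨0, ∅, ⟨?_, ?_, by simp⟩, Nat.zero_le _, le_rfl, by simp⟩ <;>
      rw [shortening_empty, hk] <;> simp
  have hspec : Q (Nat.findGreatest Q (r - v)) := Nat.findGreatest_spec (Nat.zero_le _) hQ0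
  have hmax : ∀ D, Q D → D ≤ Nat.findGreatest Q (r - v) := fun D hD =>
    Nat.le_findGreatest (hbound D hD) hD
  have hDle := hbound _ hspec
  generalize Nat.findGreatest Q (r - v) = D at hspec hmax hDle
  obtain ⟨j, T, hT, hj, hjD, hD⟩ := hspec
  have hone : ∀ B, IsRepairSet C r δ B → ¬ B ⊆ coordClosure C T →
      (T ∪ B).card = T.card + (r + (δ - 1)) := by
    intro B hB hBT
    have h1 := Finset.card_union_le T B
    have h2 := hB.1
    by_contra hne
    have h3 := hmax (D + (T.card + (r + (δ - 1)) - (T ∪ B).card))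
      ⟨j + 1, T ∪ B, hT.union hδ hB hBT, by omega, by omega, by rw [add_one_mul]; omega⟩
    omega
  refine ⟨j, D, T, hT, hjD, hDle, hD, fun B hB hBT => ?_, fun B B' hB hB' hBT hBT' => ?_⟩
  · have h1 := hone B hB hBT
    have h2 := hB.1
    have h3 := Finset.card_union_add_card_inter T B
    rw [Finset.disjoint_iff_inter_eq_empty, ← Finset.card_eq_zero]
    omega
  · have h1 := hone B hB hBT
    have h2 : (T ∪ B ∪ B').card = T.card + 2 * (r + (δ - 1)) := by
      have h1 := Finset.card_union_le (T ∪ B) B'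
      have h2 := hB'.1
      by_contra hne
      have h3 := hmax (D + (T.card + 2 * (r + (δ - 1)) - (T ∪ B ∪ B').card))
        ⟨j + 1 + 1, T ∪ B ∪ B', (hT.union hδ hB hBT).union hδ hB' hBT', by omega, by omega,
          by rw [add_one_mul, add_one_mul]; omega⟩
      omega
    have h3 := Finset.card_union_add_card_inter (T ∪ B) B'
    have h4 := hB'.1
    have h5 : (T ∪ B) ∩ B' = ∅ := by
      rw [← Finset.card_eq_zero]
      omega
    exact (Finset.disjoint_union_left.1 (Finset.disjoint_iff_inter_eq_empty.2 h5)).2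

theorem minDist_add_le_of_locality [DecidableEq K] {n w r δ u v d m : ℕ} (hδ : 1 ≤ δ)
    (hn : Fintype.card ι = n) (hnw : n = w * (r + (δ - 1)) + m)
    (hloc : ∀ i : ι, ∃ A : Finset ι, IsRepairSet C r δ A ∧ i ∈ A) (hv : 0 < v) (hvr : v ≤ r)
    (hd : ∀ c ∈ C, c ≠ 0 → d ≤ hammingNorm c) (hmδ : m ≤ δ - 1)
    (hk : Module.finrank K C = u * r + v) (hu : 2 * (r - v) + 2 ≤ u)
    (hu' : 2 * (r - v) + m ≤ u) :
    d + (u * r + v) + u * (δ - 1) + m ≤ n + 1 := by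
  classical
  by_contra! hlarge
  rw [← hn] at hlarge
  obtain ⟨j, D, T, hT, hjD, hDr, hD, hfull, hdisj⟩ :=
    exists_isRepairChain_saturated hδ hloc hv hd hmδ hlarge hk hu
  set p : Finset (Finset ι) → Prop := fun 𝓑 =>
    (∀ B ∈ 𝓑, IsRepairSet C r δ B ∧ ¬ B ⊆ coordClosure C T) ∧
      (𝓑 : Set (Finset ι)).PairwiseDisjoint id with hp
  -- A largest disjoint family of repair sets not determined by `T`.
  obtain ⟨𝓑, h𝓑, hmax⟩ := Finset.exists_max_image (Finset.univ.filter p) Finset.card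
    ⟨∅, by simp [hp]⟩
  simp only [Finset.mem_filter, Finset.mem_univ, true_and] at h𝓑 hmax
  have hchain : ∀ I : Finset (Finset ι), I ⊆ 𝓑 → j + I.card ≤ u →
      IsRepairChain C (u * r + v) r δ (j + I.card) (T ∪ I.biUnion id) := by
    intro I
    induction I using Finset.induction_on with
    | empty => intro _ _; simpa using hT
    | insert B I hBI ih =>
      intro hI hc
      rw [Finset.card_insert_of_notMem hBI] at hc ⊢
      have hB𝓑 : B ∈ 𝓑 := hI (Finset.mem_insert_self _ _)
      have hI𝓑 : I ⊆ 𝓑 := (Finset.subset_insert _ _).trans hI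
      have h1 := ih hI𝓑 (by omega)
      obtain ⟨h2, h3⟩ := h𝓑.1 B hB𝓑
      obtain ⟨h4, h5⟩ := hfull B h2 h3
      -- The closure has fewer than `m` new coordinates, too few to contain `B`, which is disjoint
      -- from the chain and has `r + (δ - 1) ≥ m` elements.
      have h6 := h1.card_coordClosure_sdiff_lt hδ hloc hv hd hlarge (by omega)
      have h7 : ¬ B ⊆ coordClosure C (T ∪ I.biUnion id) := by
        intro h
        have h8 : B ⊆ coordClosure C (T ∪ I.biUnion id) \ (T ∪ I.biUnion id) := by
          rw [Finset.subset_sdiff]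
          refine ⟨h, Finset.disjoint_union_right.2 ⟨h5.symm, ?_⟩⟩
          rw [Finset.disjoint_biUnion_right]
          intro B' hB'
          exact h𝓑.2 hB𝓑 (hI𝓑 hB') (fun h => hBI (h ▸ hB'))
        have := Finset.card_le_card h8
        omega
      have h8 := h1.union hδ h2 h7
      rwa [Finset.union_assoc, Finset.union_comm (I.biUnion id) B, ← id_eq B,
        ← Finset.biUnion_insert] at h8
  have hcard : (T ∪ 𝓑.biUnion id).card = T.card + 𝓑.card * (r + (δ - 1)) := by
    rw [Finset.card_union_of_disjoint, Finset.card_biUnion h𝓑.2]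
    · change T.card + ∑ B ∈ 𝓑, B.card = _
      rw [Finset.sum_const_nat fun B hB => (hfull B (h𝓑.1 B hB).1 (h𝓑.1 B hB).2).1]
    · rw [Finset.disjoint_biUnion_right]
      exact fun B hB => (hfull B (h𝓑.1 B hB).1 (h𝓑.1 B hB).2).2
  have hx := Finset.card_sdiff_add_card_eq_card (Finset.subset_univ (T ∪ 𝓑.biUnion id))
  rw [Finset.card_univ, hn, hcard] at hx
  -- The uncovered coordinates number `m + D` modulo `r + (δ - 1)`, and `m + D ≤ δ - 1 + (r - v)` is
  -- smaller than the modulus.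
  have hmx : m ≤ (Finset.univ \ (T ∪ 𝓑.biUnion id)).card := by
    by_contra! h
    have h1 : (j + 𝓑.card) * (r + (δ - 1)) < (w + 1) * (r + (δ - 1)) := by
      rw [add_mul, add_one_mul]; omega
    have h2 : w * (r + (δ - 1)) < (j + 𝓑.card) * (r + (δ - 1)) := by
      rw [add_mul]; omega
    have h3 := Nat.lt_of_mul_lt_mul_right h1
    have h4 := Nat.lt_of_mul_lt_mul_right h2
    omega
  obtain ⟨X, hX, hXm⟩ := Finset.exists_subset_card_eq hmx
  have hcover : ∀ x ∈ X, ∃ I ⊆ 𝓑, I.card ≤ 1 ∧ x ∈ coordClosure C (T ∪ I.biUnion id) := by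
    intro x hx
    by_cases hxT : x ∈ coordClosure C T
    · exact ⟨∅, by simp, by simp, by simpa using hxT⟩
    obtain ⟨B, hB, hxB⟩ := hloc x
    have hBT : ¬ B ⊆ coordClosure C T := fun h => hxT (h hxB)
    by_contra! hno
    -- If no member of `𝓑` helps to determine `x`, saturation makes the repair set of `x` disjoint
    -- from all of them, against maximality.
    have hBdis : ∀ B' ∈ 𝓑, Disjoint B' B := by
      intro B' hB'
      refine hdisj B' B (h𝓑.1 B' hB').1 hB (h𝓑.1 B' hB').2 fun h => ?_
      exact hno {B'} (by simpa using hB') (by simp) (by simpa using h hxB)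
    have hBnot : B ∉ 𝓑 := by
      intro hB𝓑
      have := Finset.disjoint_left.1 (hBdis B hB𝓑) hxB
      exact this hxB
    have h1 := hmax (insert B 𝓑) ⟨?_, ?_⟩
    · rw [Finset.card_insert_of_notMem hBnot] at h1
      omega
    · intro B' hB'
      rcases Finset.mem_insert.1 hB' with rfl | hB'
      · exact ⟨hB, hBT⟩
      · exact h𝓑.1 B' hB'
    · rw [Finset.coe_insert]
      exact h𝓑.2.insert fun B' hB' _ => (hBdis B' hB').symm
  choose! I hI𝓑 hI1 hIx using hcover
  have hIc : (X.biUnion I).card ≤ m := by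
    refine Finset.card_biUnion_le.trans ((Finset.sum_le_card_nsmul X _ 1 hI1).trans ?_)
    simp [hXm]
  have hIs : X.biUnion I ⊆ 𝓑 := Finset.biUnion_subset.2 hI𝓑
  have hfin := (hchain _ hIs (by omega)).card_coordClosure_sdiff_lt hδ hloc hv hd hlarge (by omega)
  have hsub : X ⊆ coordClosure C (T ∪ (X.biUnion I).biUnion id) \
      (T ∪ (X.biUnion I).biUnion id) := by
    intro x hx
    refine Finset.mem_sdiff.2 ⟨coordClosure_mono (Finset.union_subset_union_right ?_) (hIx x hx),
      fun h => (Finset.mem_sdiff.1 (hX hx)).2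
        (Finset.union_subset_union_right (Finset.biUnion_subset_biUnion_of_subset_left _ hIs) h)⟩
    exact Finset.biUnion_subset_biUnion_of_subset_left _ (Finset.subset_biUnion_of_mem I hx)
  have := Finset.card_le_card hsub
  omega

end Bound

/-! ### Moore matrices. -/

section Moore

variable {F L : Type*} [Field F] [Fintype F] [Field L] [Algebra F L]

theorem sum_smul_pow_card_pow {κ : Type*} (s : Finset κ) (x : κ → F) (β : κ → L) (i : ℕ) :
    (∑ j ∈ s, x j • β j) ^ Fintype.card F ^ i = ∑ j ∈ s, x j • β j ^ Fintype.card F ^ i := by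
  have h : ∀ y : L, (FiniteField.frobeniusAlgHom F L ^ i) y = y ^ Fintype.card F ^ i := by
    intro y
    rw [AlgHom.coe_pow, FiniteField.coe_frobeniusAlgHom, pow_iterate]
  simp_rw [← h, map_sum, map_smul]

/-- The columns of a Moore matrix with at least as many rows as columns are independent when the
entries of its first row are independent over the base field. -/
theorem eq_zero_of_moore_of_fintype {κ : Type*} [Fintype κ] {h : ℕ} (hκ : Fintype.card κ ≤ h)
    {β : κ → L} (hβ : LinearIndependent F β) {c : κ → L}
    (hc : ∀ i < h, ∑ j, β j ^ Fintype.card F ^ i * c j = 0) : c = 0 := by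
  classical
  by_contra hne
  let e := Fintype.equivFin κ
  let M : Matrix κ κ L := Matrix.of fun i j => β j ^ Fintype.card F ^ (e i : ℕ)
  have hM : M.det = 0 := by
    refine Matrix.exists_mulVec_eq_zero_iff.1 ⟨c, hne, ?_⟩
    ext i
    exact hc _ ((e i).2.trans_le hκ)
  obtain ⟨a, ha, haM⟩ := Matrix.exists_vecMul_eq_zero_iff.2 hM
  -- The left kernel vector gives a linearised polynomial vanishing on the `F`-span of `β`: `q ^
  -- |κ|` roots against degree at most `q ^ (|κ| - 1)`.
  let p : Polynomial L := ∑ i, Polynomial.C (a i) * Polynomial.X ^ Fintype.card F ^ (e i : ℕ)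
  have hq : 1 < Fintype.card F := Fintype.one_lt_card
  obtain ⟨i₀, hi₀⟩ := Function.ne_iff.1 ha
  have hp : p ≠ 0 := by
    intro h0
    have h1 : p.coeff (Fintype.card F ^ (e i₀ : ℕ)) = a i₀ := by
      simp only [p, Polynomial.finsetSum_coeff, Polynomial.coeff_C_mul, Polynomial.coeff_X_pow]
      rw [Finset.sum_eq_single i₀]
      · simp
      · intro i _ hi
        rw [if_neg, mul_zero]
        intro h2
        exact hi (e.injective (Fin.ext (Nat.pow_right_injective hq h2.symm)))
      · simp
    rw [h0, Polynomial.coeff_zero] at h1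
    exact hi₀ h1.symm
  have hdeg : p.natDegree ≤ Fintype.card F ^ (Fintype.card κ - 1) := by
    refine Polynomial.natDegree_sum_le_of_forall_le _ _ fun i _ => ?_
    refine (Polynomial.natDegree_C_mul_X_pow_le _ _).trans ?_
    exact Nat.pow_le_pow_right hq.le (by have := (e i).2; omega)
  have heval : ∀ x : κ → F, p.eval (∑ j, x j • β j) = 0 := by
    intro x
    simp only [p, Polynomial.eval_finsetSum, Polynomial.eval_mul, Polynomial.eval_C,
      Polynomial.eval_pow, Polynomial.eval_X, sum_smul_pow_card_pow, Finset.mul_sum]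
    rw [Finset.sum_comm]
    refine Finset.sum_eq_zero fun j _ => ?_
    have h1 : ∑ i, a i * β j ^ Fintype.card F ^ (e i : ℕ) = 0 := congr_fun haM j
    simp_rw [mul_smul_comm]
    rw [← Finset.smul_sum, h1, smul_zero]
  have hinj : Function.Injective fun x : κ → F => ∑ j, x j • β j :=
    linearIndependent_iff_injective_fintypeLinearCombination.1 hβ
  have h1 : (Finset.univ.image fun x : κ → F => ∑ j, x j • β j).card ≤ p.natDegree := by
    refine (Finset.card_le_card (t := p.roots.toFinset) ?_).trans
      ((Multiset.toFinset_card_le _).trans (Polynomial.card_roots' p))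
    intro y hy
    obtain ⟨x, -, rfl⟩ := Finset.mem_image.1 hy
    rw [Multiset.mem_toFinset, Polynomial.mem_roots hp]
    exact heval x
  rw [Finset.card_image_of_injective _ hinj, Finset.card_univ, Fintype.card_fun] at h1
  have h2 : 0 < Fintype.card κ := Fintype.card_pos_iff.2 ⟨i₀⟩
  have h3 := Nat.pow_lt_pow_right hq (Nat.sub_lt h2 one_pos)
  omega

theorem eq_zero_of_moore {ι : Type*} {h : ℕ} {J : Finset ι} (hJ : J.card ≤ h)
    {β : ι → L} (hβ : LinearIndependent F fun j : J => β j) {c : ι → L}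
    (hc : ∀ i < h, ∑ j ∈ J, β j ^ Fintype.card F ^ i * c j = 0) : ∀ j ∈ J, c j = 0 := by
  have h1 : (fun j : J => c j) = 0 := by
    refine eq_zero_of_moore_of_fintype (F := F) (h := h) (by rwa [Fintype.card_coe]) hβ
      fun i hi => ?_
    rw [← hc i hi]
    exact Finset.sum_coe_sort J fun j => β j ^ Fintype.card F ^ i * c j
  exact fun j hj => congr_fun h1 ⟨j, hj⟩

end Moore

/-! ### Eliminating symbols with checks over the base field. -/

section Extension

variable {F L : Type*} [Field F] [Field L] [Algebra F L] {ρ ι : Type*} [Fintype ρ] [Fintype ι]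
  [DecidableEq ι]

/-- If the columns of `H` indexed by `D` are independent, then the symbols in `D` of a word
annihilated by `H` are combinations of the other symbols, with coefficients in the base field. -/
theorem exists_eq_sum_sdiff (H : Matrix ρ ι F) (D : Finset ι)
    (hD : ∀ x : ι → F, H.mulVec x = 0 → (∀ i ∉ D, x i = 0) → x = 0) :
    ∃ a : ι → ι → F, ∀ c : ι → L, (H.map (algebraMap F L)).mulVec c = 0 → ∀ l ∈ D,
      c l = ∑ j ∈ Finset.univ \ D, algebraMap F L (a l j) * c j := by
  classical
  let N : Matrix ρ D F := H.submatrix id Subtype.val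
  have hext : ∀ y : D → F, H.mulVec (fun i => if hi : i ∈ D then y ⟨i, hi⟩ else 0) =
      N.mulVec y := by
    intro y
    ext s
    simp only [Matrix.mulVec, dotProduct, N, Matrix.submatrix_apply, id]
    rw [← Finset.sum_subset (Finset.subset_univ D), ← Finset.sum_coe_sort D]
    · simp
    · intro i _ hi
      simp [hi]
  have hN : LinearMap.ker N.mulVecLin = ⊥ := by
    rw [LinearMap.ker_eq_bot']
    intro y hy
    have h1 := hD _ ((hext y).trans hy) fun i hi => by simp [hi]
    ext i
    have h2 := congr_fun h1 i
    simpa using h2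
  -- Row reduction by a left inverse over `F` turns the columns in `D` into the identity, and
  -- remains valid over `L`.
  obtain ⟨g, hg⟩ := N.mulVecLin.exists_leftInverse_of_injective hN
  let G : Matrix D ρ F := LinearMap.toMatrix' g
  have hGN : G * N = 1 := by
    have := congr_arg LinearMap.toMatrix' hg
    rwa [LinearMap.toMatrix'_comp, ← Matrix.toLin'_apply', LinearMap.toMatrix'_toLin',
      LinearMap.toMatrix'_id] at this
  have hGH : ∀ l j : D, (G * H) l j = if l = j then 1 else 0 := by
    intro l j
    rw [← Matrix.one_apply, ← hGN]
    rfl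
  refine ⟨fun l j => if hl : l ∈ D then -(G * H) ⟨l, hl⟩ j else 0, fun c hc l hl => ?_⟩
  have h1 : ((G * H).map (algebraMap F L)).mulVec c = 0 := by
    rw [Matrix.map_mul, ← Matrix.mulVec_mulVec, hc, Matrix.mulVec_zero]
  have h2 : ∑ j, algebraMap F L ((G * H) ⟨l, hl⟩ j) * c j = 0 := congr_fun h1 ⟨l, hl⟩
  rw [← Finset.sum_sdiff (Finset.subset_univ D)] at h2
  have h3 : ∑ j ∈ D, algebraMap F L ((G * H) ⟨l, hl⟩ j) * c j = c l := by
    rw [Finset.sum_eq_single_of_mem l hl]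
    · rw [hGH ⟨l, hl⟩ ⟨l, hl⟩, if_pos rfl, map_one, one_mul]
    · intro j hj hjl
      rw [hGH ⟨l, hl⟩ ⟨j, hj⟩, if_neg, map_zero, zero_mul]
      intro h
      exact hjl (Subtype.ext_iff.1 h).symm
  rw [h3] at h2
  simp only [hl, dif_pos, map_neg, neg_mul, Finset.sum_neg_distrib]
  exact eq_neg_of_add_eq_zero_right h2

/-- A word supported on `T` that is annihilated by a matrix `H` over the base field and by the
Moore matrix of `α` vanishes, if `α` is independent on `T` and `T` is covered by `h` coordinates
together with a set `D` of independent columns of `H`. -/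
theorem eq_zero_of_mulVec_of_moore [Fintype F] {H : Matrix ρ ι F} {D T : Finset ι}
    (hD : ∀ x : ι → F, H.mulVec x = 0 → (∀ i ∉ D, x i = 0) → x = 0) (hDT : D ⊆ T) {h : ℕ}
    (hcard : (T \ D).card ≤ h) {α : ι → L} (hα : LinearIndependent F fun j : T => α j)
    {c : ι → L} (hc : (H.map (algebraMap F L)).mulVec c = 0)
    (hcα : ∀ i < h, ∑ j, α j ^ Fintype.card F ^ i * c j = 0) (hcT : ∀ i ∉ T, c i = 0) :
    c = 0 := by
  obtain ⟨a, ha⟩ := exists_eq_sum_sdiff (L := L) H D hD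
  have hac : ∀ l ∈ D, c l = ∑ j ∈ T \ D, algebraMap F L (a l j) * c j := by
    intro l hl
    rw [ha c hc l hl]
    refine (Finset.sum_subset (Finset.sdiff_subset_sdiff (Finset.subset_univ T) subset_rfl)
      fun j hj hj' => ?_).symm
    rw [hcT j fun h => hj' (Finset.mem_sdiff.2 ⟨h, (Finset.mem_sdiff.1 hj).2⟩), mul_zero]
  -- Substituting the symbols in `D` into the Moore equations yields the Moore equations of `β` on
  -- `T \ D`, because the coefficients in `F` are fixed by Frobenius.
  let β : ι → L := fun j => α j + ∑ l ∈ D, a l j • α l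
  have hβ : LinearIndependent F fun j : (T \ D : Finset ι) => β j := by
    change LinearIndepOn F β ((T \ D : Finset ι) : Set ι)
    rw [linearIndepOn_finset_iff]
    intro x hx
    have hα' : LinearIndepOn F α (T : Set ι) := hα
    rw [linearIndepOn_finset_iff] at hα'
    -- A relation among the `β j` expands to one among the `α j` on `T` with the same coefficients
    -- off `D`.
    have h1 := hα' (fun j => if j ∈ D then ∑ i ∈ T \ D, x i * a j i else x j) (by
      rw [← hx, ← Finset.sum_sdiff hDT]
      simp only [β, smul_add, Finset.sum_add_distrib]
      congr 1
      · exact Finset.sum_congr rfl fun j hj => by rw [if_neg (Finset.mem_sdiff.1 hj).2]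
      · simp_rw [Finset.smul_sum]
        rw [Finset.sum_comm]
        refine Finset.sum_congr rfl fun j hj => ?_
        rw [if_pos hj, Finset.sum_smul]
        simp_rw [mul_smul])
    intro j hj
    have h2 := h1 j (Finset.mem_sdiff.1 hj).1
    rwa [if_neg (Finset.mem_sdiff.1 hj).2] at h2
  have hzero : ∀ j ∈ T \ D, c j = 0 := by
    refine eq_zero_of_moore hcard hβ fun i hi => ?_
    rw [← hcα i hi, ← Finset.sum_subset (Finset.subset_univ T)
      (fun j _ hj => by rw [hcT j hj, mul_zero]), ← Finset.sum_sdiff hDT]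
    have h1 : ∑ l ∈ D, α l ^ Fintype.card F ^ i * c l =
        ∑ j ∈ T \ D, (∑ l ∈ D, a l j • α l) ^ Fintype.card F ^ i * c j := by
      simp_rw [sum_smul_pow_card_pow, Finset.sum_mul]
      rw [Finset.sum_comm]
      refine Finset.sum_congr rfl fun l hl => ?_
      rw [hac l hl, Finset.mul_sum]
      refine Finset.sum_congr rfl fun j _ => ?_
      rw [Algebra.smul_def]
      ring
    rw [h1, ← Finset.sum_add_distrib]
    refine Finset.sum_congr rfl fun j _ => ?_
    -- Additivity of the Frobenius power, as the case of two summands with coefficient `1`.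
    have h2 := sum_smul_pow_card_pow (F := F) (Finset.univ : Finset Bool) (fun _ => 1)
      (fun b => if b then α j else ∑ l ∈ D, a l j • α l) i
    simp only [Fintype.sum_bool, one_smul, if_true, Bool.false_eq_true, if_false] at h2
    rw [← add_mul, ← h2]
  ext i
  by_cases hiT : i ∈ T
  · by_cases hiD : i ∈ D
    · rw [hac i hiD]
      exact Finset.sum_eq_zero fun j hj => by rw [hzero j hj, mul_zero]
    · exact hzero i (Finset.mem_sdiff.2 ⟨hiT, hiD⟩)
  · exact hcT i hiT

end Extension

/-! ### Code parameters and local recovery. -/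

section Params

variable {ι K : Type*} [Fintype ι] [Field K] {C : Submodule K (ι → K)} {n k d : ℕ}

theorem IsLinearCodeWithParams.le_hammingNorm [DecidableEq K]
    (hC : IsLinearCodeWithParams C n k d) {c : ι → K} (hc : c ∈ C) (hc0 : c ≠ 0) :
    d ≤ hammingNorm c := by
  have h : d ≤ hammingDist c 0 := hC.2.2.2 ⟨c, hc, 0, C.zero_mem, hc0, by congr!⟩
  rwa [hammingDist_zero_right] at h

theorem IsLinearCodeWithParams.eq_zero_of_card_lt (hC : IsLinearCodeWithParams C n k d)
    {D : Finset ι} (hD : D.card < d) {c : ι → K} (hc : c ∈ C) (hcD : ∀ i ∉ D, c i = 0) :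
    c = 0 := by
  classical
  by_contra hc0
  have h1 := hC.le_hammingNorm hc hc0
  have h2 : hammingNorm c ≤ D.card := by
    refine Finset.card_le_card fun i hi => ?_
    by_contra hiD
    exact (Finset.mem_filter.1 hi).2 (hcD i hiD)
  omega

/-- The minimum distance of a code with a nonzero codeword whose distance is known from both
sides. -/
theorem isLinearCodeWithParams_of_bounds (hn : Fintype.card ι = n) (hk : Module.finrank K C = k)
    (hk0 : 0 < k) (hlow : ∀ (D : Finset ι) (c : ι → K), c ∈ C → D.card < d → (∀ i ∉ D, c i = 0) →
      c = 0) (hup : ∀ d', IsLinearCodeWithParams C n k d' → d' ≤ d) :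
    IsLinearCodeWithParams C n k d := by
  classical
  have hne : C ≠ ⊥ := by
    rintro rfl
    rw [finrank_bot] at hk
    omega
  obtain ⟨x, hx, hx0⟩ := Submodule.exists_mem_ne_zero_of_ne_bot hne
  have hP : ∃ e, ∃ x ∈ C, ∃ y ∈ C, x ≠ y ∧ hammingDist x y = e :=
    ⟨_, x, hx, 0, C.zero_mem, hx0, rfl⟩
  have hmin : IsLinearCodeWithParams C n k (Nat.find hP) := by
    refine ⟨hn, hk, ?_, ?_⟩
    · obtain ⟨x, hx, y, hy, hxy, he⟩ := Nat.find_spec hP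
      exact ⟨x, hx, y, hy, hxy, by convert he⟩
    · rintro e ⟨x, hx, y, hy, hxy, he⟩
      exact Nat.find_min' hP ⟨x, hx, y, hy, hxy, by convert he⟩
  have h1 : d ≤ Nat.find hP := by
    obtain ⟨x, hx, y, hy, hxy, he⟩ := Nat.find_spec hP
    by_contra! hlt
    refine hxy (sub_eq_zero.1 (hlow (Finset.univ.filter fun i => x i ≠ y i) (x - y)
      (C.sub_mem hx hy) ?_ fun i hi => ?_))
    · rw [← he] at hlt
      exact hlt
    · simpa [sub_eq_zero] using hi
  rwa [le_antisymm (hup _ hmin) h1] at hmin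

theorem card_le_finrank_ker_mulVecLin {ρ : Type*} [Fintype ρ] (H : Matrix ρ ι K) :
    Fintype.card ι ≤ Module.finrank K (LinearMap.ker H.mulVecLin) + Fintype.card ρ := by
  have h1 := LinearMap.finrank_range_add_finrank_ker H.mulVecLin
  have h2 := Submodule.finrank_le (LinearMap.range H.mulVecLin)
  rw [Module.finrank_fintype_fun_eq_card] at h1 h2
  omega

/-- The symbols of a word of a code with distance greater than `δ - 1` (after extension of
scalars) are determined by all but `δ - 1` of its symbols. -/
theorem exists_eq_sum_of_minDist {F L ρ κ : Type*} [Field F] [Field L] [Algebra F L] [Fintype ρ]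
    [Fintype κ] [DecidableEq κ] {P : Matrix ρ κ F} {n k d : ℕ}
    (hP : IsLinearCodeWithParams (parityCheckCode P) n k d) {I : Finset κ} (hI : n < I.card + d)
    {l : κ} (hl : l ∉ I) :
    ∃ a : κ → L, ∀ c : κ → L, (P.map (algebraMap F L)).mulVec c = 0 →
      c l = ∑ i ∈ I, a i * c i := by
  have hD : ∀ x : κ → F, P.mulVec x = 0 → (∀ i ∉ (Finset.univ \ I), x i = 0) → x = 0 := by
    intro x hx hxI
    refine hP.eq_zero_of_card_lt (D := Finset.univ \ I) ?_ hx hxI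
    rw [Finset.card_univ_sdiff, hP.1]
    have := Finset.card_le_univ I
    have := hP.1
    omega
  obtain ⟨a, ha⟩ := exists_eq_sum_sdiff (L := L) P _ hD
  refine ⟨fun i => algebraMap F L (a l i), fun c hc => ?_⟩
  rw [ha c hc l (by simpa using hl), sdiff_sdiff_right_self]
  simp

end Params

section Locality

/-- More than `n - d` symbols of a block determine the whole block. Allowing `A` to be a proper part
of it serves the first block, which is longer than a repair set may be. -/
theorem isRepairSet_map {F L ρ κ ι : Type*} [Field F] [Field L] [Algebra F L] [Fintype ρ]
    [Fintype κ] [DecidableEq κ] [DecidableEq ι] {P : Matrix ρ κ F} {n k d : ℕ}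
    (hP : IsLinearCodeWithParams (parityCheckCode P) n k d) (C : Submodule L (ι → L)) (f : κ ↪ ι)
    (hC : ∀ c ∈ C, (P.map (algebraMap F L)).mulVec (c ∘ f) = 0) {r δ : ℕ} {A : Finset κ}
    (hA : A.card ≤ r + δ - 1) (hd : n < A.card - (δ - 1) + d) :
    IsRepairSet C r δ (A.map f) := by
  refine ⟨by rwa [Finset.card_map], fun l hl I hI hlI hIc => ?_⟩
  obtain ⟨l, hlA, rfl⟩ := Finset.mem_map.1 hl
  obtain ⟨I, hIA, rfl⟩ := Finset.subset_map_iff.1 hI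
  rw [Finset.card_map, Finset.card_map] at hIc
  obtain ⟨a, ha⟩ := exists_eq_sum_of_minDist (L := L) hP (I := I) (by omega) (l := l)
    (fun h => hlI (Finset.mem_map_of_mem f h))
  refine ⟨Function.extend f a 0, fun c hc => ?_⟩
  rw [Finset.sum_map]
  refine (ha (c ∘ f) (hC c hc)).trans (Finset.sum_congr rfl fun i _ => ?_)
  rw [f.injective.extend_apply, Function.comp_apply]

end Locality

/-! ### Block structure and the counting of excess coordinates. -/

section Blocks

theorem fromBlocks_blockDiagonal_mulVec_eq_zero_iff {R ρ₁ ρ₂ κ₁ κ₂ B : Type*} [CommRing R]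
    [Fintype κ₁] [Fintype κ₂] [Fintype B] [DecidableEq B]
    (P₁ : Matrix ρ₁ κ₁ R) (P₂ : Matrix ρ₂ κ₂ R) (c : κ₁ ⊕ κ₂ × B → R) :
    (Matrix.fromBlocks P₁ 0 0 (Matrix.blockDiagonal fun _ : B => P₂)).mulVec c = 0 ↔
      P₁.mulVec (fun x => c (Sum.inl x)) = 0 ∧
        ∀ b, P₂.mulVec (fun x => c (Sum.inr (x, b))) = 0 := by
  have h : ∀ i b, (Matrix.blockDiagonal fun _ : B => P₂).mulVec (c ∘ Sum.inr) (i, b) =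
      P₂.mulVec (fun x => c (Sum.inr (x, b))) i := by
    intro i b
    simp [Matrix.mulVec, dotProduct, Matrix.blockDiagonal_apply, Fintype.sum_prod_type, ite_mul]
  rw [Matrix.fromBlocks_mulVec, Matrix.zero_mulVec, Matrix.zero_mulVec, add_zero, zero_add]
  constructor
  · intro hc
    refine ⟨funext fun i => congr_fun hc (Sum.inl i), fun b => funext fun i => ?_⟩
    rw [← h]
    exact congr_fun hc (Sum.inr (i, b))
  · rintro ⟨h1, h2⟩
    ext (i | ⟨i, b⟩)
    · exact congr_fun h1 i
    · exact (h i b).trans (congr_fun (h2 b) i)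

variable {κ₁ κ₂ B : Type*} [Fintype κ₂] [Fintype B] [DecidableEq κ₂]

/-- The set of coordinates with prescribed parts in each block. -/
def blockFinset (S₁ : Finset κ₁) (S₂ : B → Finset κ₂) : Finset (κ₁ ⊕ κ₂ × B) :=
  S₁.disjSum (Finset.univ.filter fun p => p.1 ∈ S₂ p.2)

@[simp]
theorem inl_mem_blockFinset {S₁ : Finset κ₁} {S₂ : B → Finset κ₂} {x : κ₁} :
    Sum.inl x ∈ blockFinset S₁ S₂ ↔ x ∈ S₁ := by
  simp [blockFinset]

@[simp]
theorem inr_mem_blockFinset {S₁ : Finset κ₁} {S₂ : B → Finset κ₂} {x : κ₂} {b : B} :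
    Sum.inr (x, b) ∈ blockFinset S₁ S₂ ↔ x ∈ S₂ b := by
  simp [blockFinset]

theorem card_blockFinset (S₁ : Finset κ₁) (S₂ : B → Finset κ₂) :
    (blockFinset S₁ S₂).card = S₁.card + ∑ b, (S₂ b).card := by
  rw [blockFinset, Finset.card_disjSum, Finset.card_filter, Fintype.sum_prod_type_right]
  simp

theorem eq_blockFinset [Fintype κ₁] [DecidableEq κ₁] [DecidableEq B]
    (T : Finset (κ₁ ⊕ κ₂ × B)) :
    T = blockFinset (Finset.univ.filter fun x => Sum.inl x ∈ T)
      fun b => Finset.univ.filter fun x => Sum.inr (x, b) ∈ T := by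
  ext (x | ⟨x, b⟩) <;> simp

theorem blockFinset_sdiff [DecidableEq κ₁] [DecidableEq B]
    (S₁ T₁ : Finset κ₁) (S₂ T₂ : B → Finset κ₂) :
    blockFinset S₁ S₂ \ blockFinset T₁ T₂ = blockFinset (S₁ \ T₁) fun b => S₂ b \ T₂ b := by
  ext (x | ⟨x, b⟩) <;> simp

/-- A set with few coordinates in each block indexes independent columns of the block diagonal
parity-check matrix. -/
theorem eq_zero_of_fromBlocks_mulVec {F ρ₁ ρ₂ : Type*} [Field F] [Fintype κ₁] [DecidableEq B]
    {P₁ : Matrix ρ₁ κ₁ F} {P₂ : Matrix ρ₂ κ₂ F} {n₁ k₁ d₁ n₂ k₂ d₂ : ℕ}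
    (hP₁ : IsLinearCodeWithParams (parityCheckCode P₁) n₁ k₁ d₁)
    (hP₂ : IsLinearCodeWithParams (parityCheckCode P₂) n₂ k₂ d₂)
    {D₁ : Finset κ₁} {D₂ : B → Finset κ₂} (hD₁ : D₁.card < d₁) (hD₂ : ∀ b, (D₂ b).card < d₂)
    (x : κ₁ ⊕ κ₂ × B → F)
    (hx : (Matrix.fromBlocks P₁ 0 0 (Matrix.blockDiagonal fun _ : B => P₂)).mulVec x = 0)
    (hxD : ∀ i ∉ blockFinset D₁ D₂, x i = 0) : x = 0 := by
  rw [fromBlocks_blockDiagonal_mulVec_eq_zero_iff] at hx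
  have h1 := hP₁.eq_zero_of_card_lt hD₁ hx.1 fun i hi => hxD _ (by simpa using hi)
  have h2 := fun b => hP₂.eq_zero_of_card_lt (hD₂ b) (hx.2 b) fun i hi => hxD _ (by simpa using hi)
  ext (i | ⟨i, b⟩)
  · exact congr_fun h1 i
  · exact congr_fun (h2 b) i

/-- Either at least `N` of the `x i` exceed `s`, and the subtraction removes at least `N * s` in
total, or fewer than `N` terms survive, each at most `r`. -/
theorem sum_tsub_le {I : Type*} [Fintype I] (x : I → ℕ) {s r h N : ℕ}
    (hx : ∀ i, x i - s ≤ r) (hsum : ∑ i, x i ≤ h + N * s) (hN : (N - 1) * r ≤ h) :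
    ∑ i, (x i - s) ≤ h := by
  classical
  set A : Finset I := Finset.univ.filter fun i => s < x i with hA
  have h1 : ∑ i ∈ A, (x i - s) = ∑ i, (x i - s) := by
    refine Finset.sum_subset (Finset.subset_univ A) fun i _ hi => ?_
    simp only [hA, Finset.mem_filter, Finset.mem_univ, true_and, not_lt] at hi
    omega
  rw [← h1]
  rcases le_or_gt N A.card with hle | hlt
  · have h2 : ∑ i ∈ A, (x i - s) + A.card * s = ∑ i ∈ A, x i := by
      rw [← smul_eq_mul, ← Finset.sum_const, ← Finset.sum_add_distrib]
      refine Finset.sum_congr rfl fun i hi => ?_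
      have := (Finset.mem_filter.1 hi).2
      omega
    have h3 : ∑ i ∈ A, x i ≤ ∑ i, x i :=
      Finset.sum_le_sum_of_subset (Finset.subset_univ A)
    have h4 : N * s ≤ A.card * s := Nat.mul_le_mul_right s hle
    omega
  · refine (Finset.sum_le_card_nsmul A _ r fun i _ => hx i).trans ?_
    rw [smul_eq_mul]
    exact (Nat.mul_le_mul_right r (by omega)).trans hN

theorem IsWiseIndependent.linearIndependent {F L ι : Type*} [Field F] [Field L] [Algebra F L]
    {α : ι → L} (hα : Function.Injective α) {t : ℕ} (hS : IsWiseIndependent F (Set.range α) t)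
    {T : Finset ι} (hT : T.card ≤ t) : LinearIndependent F fun j : T => α j := by
  classical
  have h1 := hS (T.image α) (by simp) (Finset.card_image_le.trans hT)
  exact h1.comp (fun j : T => (⟨α j, Finset.mem_image_of_mem α j.2⟩ : T.image α))
    fun i j hij => Subtype.ext (hα (Subtype.ext_iff.1 hij))

end Blocks

/-! ### Dimension, distance and locality of the constructed code. -/

section Construction

variable {F L : Type*} [Field F] [Fintype F] [Field L] [Algebra F L] {w r δ m : ℕ}

theorem mem_parityCheckCode_blockParityCheck {h : ℕ}
    {P₁ : Matrix (Fin (m + δ - 1)) (Fin (m + r + δ - 1)) F}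
    {P₂ : Matrix (Fin (δ - 1)) (Fin (r + δ - 1)) F} {α c : BlockCoord w r δ m → L} :
    c ∈ parityCheckCode (blockParityCheck h P₁ P₂ α) ↔
      ((Matrix.fromBlocks P₁ 0 0
        (Matrix.blockDiagonal fun _ : Fin (w - 1) => P₂)).map (algebraMap F L)).mulVec c = 0 ∧
      ∀ i < h, ∑ j, α j ^ Fintype.card F ^ i * c j = 0 := by
  have hmap : (Matrix.fromBlocks P₁ 0 0
      (Matrix.blockDiagonal fun _ : Fin (w - 1) => P₂)).map (algebraMap F L) =
      Matrix.fromBlocks (P₁.map (algebraMap F L)) 0 0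
        (Matrix.blockDiagonal fun _ : Fin (w - 1) => P₂.map (algebraMap F L)) := by
    rw [Matrix.fromBlocks_map, Matrix.blockDiagonal_map _ _ (map_zero _),
      Matrix.map_zero _ (map_zero _), Matrix.map_zero _ (map_zero _)]
  rw [parityCheckCode, LinearMap.mem_ker, Matrix.mulVecLin_apply, blockParityCheck,
    Matrix.fromRows_mulVec, hmap]
  constructor
  · intro hc
    refine ⟨funext fun i => congr_fun hc (Sum.inl i), fun i hi => ?_⟩
    exact congr_fun hc (Sum.inr ⟨i, hi⟩)
  · rintro ⟨h1, h2⟩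
    ext (i | i)
    · exact congr_fun h1 i
    · exact h2 i i.2

theorem mulVec_block_eq_zero {h : ℕ}
    {P₁ : Matrix (Fin (m + δ - 1)) (Fin (m + r + δ - 1)) F}
    {P₂ : Matrix (Fin (δ - 1)) (Fin (r + δ - 1)) F} {α c : BlockCoord w r δ m → L}
    (hc : c ∈ parityCheckCode (blockParityCheck h P₁ P₂ α)) :
    (P₁.map (algebraMap F L)).mulVec (fun x => c (Sum.inl x)) = 0 ∧
      ∀ b, (P₂.map (algebraMap F L)).mulVec (fun x => c (Sum.inr (x, b))) = 0 := by
  rw [← fromBlocks_blockDiagonal_mulVec_eq_zero_iff]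
  have := (mem_parityCheckCode_blockParityCheck.1 hc).1
  rwa [Matrix.fromBlocks_map, Matrix.blockDiagonal_map _ _ (map_zero _),
      Matrix.map_zero _ (map_zero _), Matrix.map_zero _ (map_zero _)] at this

theorem eq_zero_of_mem_blockParityCheck {h N t : ℕ} (hm : 0 < m) (hδ : 2 ≤ δ)
    {P₁ : Matrix (Fin (m + δ - 1)) (Fin (m + r + δ - 1)) F}
    (hP₁ : IsLinearCodeWithParams (parityCheckCode P₁) (m + r + δ - 1) r (m + δ))
    {P₂ : Matrix (Fin (δ - 1)) (Fin (r + δ - 1)) F}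
    (hP₂ : IsLinearCodeWithParams (parityCheckCode P₂) (r + δ - 1) r δ)
    {α : BlockCoord w r δ m → L} (hα : Function.Injective α)
    (hS : IsWiseIndependent F (Set.range α) t) (ht : h + N * (δ - 1) ≤ t) (hN : (N - 1) * r ≤ h)
    {T : Finset (BlockCoord w r δ m)} (hT : T.card ≤ h + N * (δ - 1))
    {c : BlockCoord w r δ m → L} (hc : c ∈ parityCheckCode (blockParityCheck h P₁ P₂ α))
    (hcT : ∀ i ∉ T, c i = 0) : c = 0 := by
  classical
  set T₁ : Finset (Fin (m + r + δ - 1)) := Finset.univ.filter fun x => Sum.inl x ∈ T with hT₁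
  set T₂ : Fin (w - 1) → Finset (Fin (r + δ - 1)) :=
    fun b => Finset.univ.filter fun x => Sum.inr (x, b) ∈ T with hT₂
  have hTb : T = blockFinset T₁ T₂ := eq_blockFinset T
  obtain ⟨D₁, hD₁, hD₁c⟩ := Finset.exists_subset_card_eq
    (Nat.min_le_left T₁.card (m + (δ - 1)))
  have hD : ∀ b, ∃ D ⊆ T₂ b, D.card = min (T₂ b).card (δ - 1) := fun b =>
    Finset.exists_subset_card_eq (Nat.min_le_left _ _)
  choose D₂ hD₂ hD₂c using hD
  have hsub : blockFinset D₁ D₂ ⊆ T := by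
    rw [hTb]
    rintro (x | ⟨x, b⟩) hx
    · simpa using hD₁ (by simpa using hx)
    · simpa using hD₂ b (by simpa using hx)
  obtain ⟨h1, h2⟩ := mem_parityCheckCode_blockParityCheck.1 hc
  refine eq_zero_of_mulVec_of_moore
    (eq_zero_of_fromBlocks_mulVec hP₁ hP₂ (D₁ := D₁) (D₂ := D₂) (by omega) fun b => ?_)
    hsub (h := h) ?_ (hS.linearIndependent hα (hT.trans ht)) h1 h2 hcT
  · rw [hD₂c]
    omega
  rw [hTb, card_blockFinset] at hT
  rw [hTb, blockFinset_sdiff, card_blockFinset, Finset.card_sdiff_of_subset hD₁, hD₁c]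
  simp_rw [Finset.card_sdiff_of_subset (hD₂ _), hD₂c]
  have h3 := Finset.card_le_univ T₁
  rw [Fintype.card_fin] at h3
  -- `none` is the first block. Lowering its count by `m` gives it, like the others, an excess over
  -- `δ - 1` of at most `r`.
  have h4 := sum_tsub_le (fun o : Option (Fin (w - 1)) => o.elim (T₁.card - m) fun b => (T₂ b).card)
    (s := δ - 1) (r := r) (h := h) (N := N) (fun o => ?_) ?_ hN
  · rw [Fintype.sum_option] at h4
    simp only [Option.elim] at h4
    refine le_trans (add_le_add ?_ (Finset.sum_le_sum fun b _ => ?_)) h4 <;> omega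
  · rcases o with _ | b
    · simp only [Option.elim]; omega
    · have h5 := Finset.card_le_univ (T₂ b)
      rw [Fintype.card_fin] at h5
      simp only [Option.elim]; omega
  · rw [Fintype.sum_option]
    simp only [Option.elim]
    omega

theorem card_blockCoord (hw : 1 ≤ w) (hδ : 1 ≤ δ) :
    Fintype.card (BlockCoord w r δ m) = w * (r + (δ - 1)) + m := by
  obtain ⟨w, rfl⟩ := Nat.exists_eq_add_of_le' hw
  simp only [Fintype.card_sum, Fintype.card_prod, Fintype.card_fin, Nat.add_sub_cancel]
  rw [add_one_mul, Nat.add_sub_assoc hδ, Nat.add_sub_assoc hδ, mul_comm w]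
  omega

/-- The parity-check matrix has `n - k` rows. -/
theorem le_finrank_blockParityCheck {h k : ℕ} (hw : 1 ≤ w) (hδ : 1 ≤ δ) (hk : h + k = w * r)
    (P₁ : Matrix (Fin (m + δ - 1)) (Fin (m + r + δ - 1)) F)
    (P₂ : Matrix (Fin (δ - 1)) (Fin (r + δ - 1)) F) (α : BlockCoord w r δ m → L) :
    k ≤ Module.finrank L (parityCheckCode (blockParityCheck h P₁ P₂ α)) := by
  have h1 := card_le_finrank_ker_mulVecLin (blockParityCheck h P₁ P₂ α)
  rw [card_blockCoord hw hδ] at h1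
  simp only [Fintype.card_sum, Fintype.card_prod, Fintype.card_fin] at h1
  rw [parityCheckCode]
  generalize Module.finrank L (LinearMap.ker (blockParityCheck h P₁ P₂ α).mulVecLin) = x at h1 ⊢
  clear α
  obtain ⟨w, rfl⟩ := Nat.exists_eq_add_of_le' hw
  rw [Nat.add_sub_cancel, mul_comm (δ - 1), mul_add, add_one_mul w (δ - 1)] at h1
  omega

/-- A word vanishing on `r` symbols in each of `u` blocks, the first included, and on `v` symbols of
one more vanishes on those `u` blocks by the MDS property. What is left of its support is small
enough for `hlow`, so `u * r + v` symbols determine a word. -/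
theorem finrank_blockParityCheck_le {h u v : ℕ} (hm : 0 < m) (hδ : 2 ≤ δ)
    (hk : h + (u * r + v) = w * r) (hu : 1 ≤ u) (hv : 0 < v) (hvr : v ≤ r)
    {P₁ : Matrix (Fin (m + δ - 1)) (Fin (m + r + δ - 1)) F}
    (hP₁ : IsLinearCodeWithParams (parityCheckCode P₁) (m + r + δ - 1) r (m + δ))
    {P₂ : Matrix (Fin (δ - 1)) (Fin (r + δ - 1)) F}
    (hP₂ : IsLinearCodeWithParams (parityCheckCode P₂) (r + δ - 1) r δ)
    {α : BlockCoord w r δ m → L}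
    (hlow : ∀ (T : Finset (BlockCoord w r δ m)) (c : BlockCoord w r δ m → L),
      c ∈ parityCheckCode (blockParityCheck h P₁ P₂ α) → T.card ≤ h + (w - u) * (δ - 1) →
      (∀ i ∉ T, c i = 0) → c = 0) :
    Module.finrank L (parityCheckCode (blockParityCheck h P₁ P₂ α)) ≤ u * r + v := by
  classical
  have huw : u < w := by
    by_contra! hle
    have := Nat.mul_le_mul_right r hle
    omega
  obtain ⟨S₁, -, hS₁⟩ := Finset.exists_subset_card_eq
    (s := (Finset.univ : Finset (Fin (m + r + δ - 1)))) (n := r)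
    (by rw [Finset.card_univ, Fintype.card_fin]; omega)
  obtain ⟨R, -, hR⟩ := Finset.exists_subset_card_eq
    (s := (Finset.univ : Finset (Fin (r + δ - 1)))) (n := r)
    (by rw [Finset.card_univ, Fintype.card_fin]; omega)
  obtain ⟨V, -, hV⟩ := Finset.exists_subset_card_eq
    (s := (Finset.univ : Finset (Fin (r + δ - 1)))) (n := v)
    (by rw [Finset.card_univ, Fintype.card_fin]; omega)
  obtain ⟨U', -, hU'⟩ := Finset.exists_subset_card_eq
    (s := (Finset.univ : Finset (Fin (w - 1)))) (n := u - 1 + 1)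
    (by rw [Finset.card_univ, Fintype.card_fin]; omega)
  obtain ⟨b₁, U, hb₁, rfl, hU⟩ := Finset.card_eq_succ.1 hU'
  set S₂ : Fin (w - 1) → Finset (Fin (r + δ - 1)) :=
    fun b => if b ∈ U then R else if b = b₁ then V else ∅ with hS₂
  set Z₂ : Fin (w - 1) → Finset (Fin (r + δ - 1)) :=
    fun b => if b ∈ U then ∅ else if b = b₁ then Finset.univ \ V else Finset.univ with hZ₂
  have hS₂c : ∑ b, (S₂ b).card = (u - 1) * r + v := by
    have h1 : ∀ b, (S₂ b).card = (if b ∈ U then r else 0) + if b = b₁ then v else 0 := by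
      intro b
      by_cases hb : b ∈ U
      · have hbb : b ≠ b₁ := fun h => hb₁ (h ▸ hb)
        simp [hS₂, hb, hbb, hR]
      · by_cases hbb : b = b₁ <;> simp [hS₂, hb, hbb, hV, hb₁]
    simp [h1, Finset.sum_add_distrib, hU]
  have hZ₂c : ∑ b, (Z₂ b).card + ((u - 1) * (r + (δ - 1)) + v) = (w - 1) * (r + (δ - 1)) := by
    have h1 : ∀ b, (Z₂ b).card + ((if b ∈ U then r + (δ - 1) else 0) + if b = b₁ then v else 0) =
        r + (δ - 1) := by
      intro b
      by_cases hb : b ∈ U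
      · have hbb : b ≠ b₁ := fun h => hb₁ (h ▸ hb)
        simp [hZ₂, hb, hbb]
      · by_cases hbb : b = b₁
        · have := Finset.card_sdiff_add_card_eq_card (Finset.subset_univ V)
          rw [Finset.card_univ, Fintype.card_fin, hV] at this
          simp only [hZ₂, hbb, hb₁, if_true, if_false]
          omega
        · simp only [hZ₂, hb, hbb, if_false, Finset.card_univ, Fintype.card_fin]
          omega
    have h2 := Finset.sum_congr (rfl : (Finset.univ : Finset (Fin (w - 1))) = _) fun b _ => h1 b
    rw [Finset.sum_add_distrib, Finset.sum_add_distrib] at h2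
    simpa [hU] using h2
  -- The remaining coordinates number `(w - u) * (r + (δ - 1)) - v`, which equals `h + (w - u) * (δ
  -- - 1)`.
  have hZ : (blockFinset (∅ : Finset (Fin (m + r + δ - 1))) Z₂).card ≤ h + (w - u) * (δ - 1) := by
    rw [card_blockFinset, Finset.card_empty, zero_add]
    clear hlow
    generalize ∑ b, (Z₂ b).card = z at hZ₂c ⊢
    obtain ⟨u, rfl⟩ := Nat.exists_eq_add_of_le' hu
    obtain ⟨t, rfl⟩ := Nat.exists_eq_add_of_lt huw
    have e1 : u + 1 + t + 1 - (u + 1) = t + 1 := by omega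
    have e2 : u + 1 + t + 1 - 1 = u + (t + 1) := by omega
    rw [e1]
    rw [e2, Nat.add_sub_cancel] at hZ₂c
    have e3 : u + 1 + t + 1 = (u + 1) + (t + 1) := by omega
    rw [e3, add_mul (u + 1)] at hk
    rw [add_mul u (t + 1), mul_add (t + 1)] at hZ₂c
    omega
  have hzero : shortening (parityCheckCode (blockParityCheck h P₁ P₂ α))
      (blockFinset S₁ S₂) = ⊥ := by
    rw [eq_bot_iff]
    intro c hc
    rw [mem_shortening] at hc
    obtain ⟨hc, hcS⟩ := hc
    obtain ⟨hc1, hc2⟩ := mulVec_block_eq_zero hc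
    refine (Submodule.mem_bot L).2 (hlow _ c hc hZ ?_)
    rintro (x | ⟨x, b⟩) hx
    · by_cases hxS : x ∈ S₁
      · exact hcS _ (by simpa using hxS)
      obtain ⟨a, ha⟩ := exists_eq_sum_of_minDist (L := L) hP₁ (I := S₁) (by omega) hxS
      rw [ha _ hc1]
      exact Finset.sum_eq_zero fun i hi => by rw [hcS _ (by simpa using hi), mul_zero]
    · rw [inr_mem_blockFinset] at hx
      by_cases hb : b ∈ U
      · by_cases hxR : x ∈ R
        · exact hcS _ (by simpa [hS₂, hb] using hxR)
        obtain ⟨a, ha⟩ := exists_eq_sum_of_minDist (L := L) hP₂ (I := R) (by omega) hxR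
        rw [ha _ (hc2 b)]
        exact Finset.sum_eq_zero fun i hi => by
          rw [hcS _ (by simpa [hS₂, hb] using hi), mul_zero]
      · by_cases hbb : b = b₁
        · exact hcS _ (by simpa [hS₂, hZ₂, hb, hbb, hb₁] using hx)
        · simp [hZ₂, hb, hbb] at hx
  have h1 := finrank_shortening_le_union
    (C := parityCheckCode (blockParityCheck h P₁ P₂ α)) ∅ (blockFinset S₁ S₂)
  rw [shortening_empty, Finset.empty_union, Finset.sdiff_empty, hzero, finrank_bot,
    card_blockFinset, hS₁, hS₂c] at h1
  obtain ⟨u, rfl⟩ := Nat.exists_eq_add_of_le' hu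
  rw [Nat.add_sub_cancel] at h1
  rw [add_one_mul]
  omega

theorem hasAllSymbolLocality_blockParityCheck {h : ℕ} (hm : 0 < m) (hδ : 2 ≤ δ) (hr : 1 ≤ r)
    {P₁ : Matrix (Fin (m + δ - 1)) (Fin (m + r + δ - 1)) F}
    (hP₁ : IsLinearCodeWithParams (parityCheckCode P₁) (m + r + δ - 1) r (m + δ))
    {P₂ : Matrix (Fin (δ - 1)) (Fin (r + δ - 1)) F}
    (hP₂ : IsLinearCodeWithParams (parityCheckCode P₂) (r + δ - 1) r δ)
    {α : BlockCoord w r δ m → L}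
    (hk : r ≤ Module.finrank L (parityCheckCode (blockParityCheck h P₁ P₂ α))) :
    HasAllSymbolLocality (parityCheckCode (blockParityCheck h P₁ P₂ α)) r δ := by
  classical
  refine ⟨hr, hk, hδ, ?_⟩
  rintro (x | ⟨x, b⟩)
  · obtain ⟨A, hxA, -, hA⟩ := Finset.exists_subsuperset_card_eq (n := r + (δ - 1))
      (Finset.subset_univ {x}) (by rw [Finset.card_singleton]; omega)
      (by rw [Finset.card_univ, Fintype.card_fin]; omega)
    exact ⟨A.map ⟨Sum.inl, Sum.inl_injective⟩,
      isRepairSet_map hP₁ _ _ (fun c hc => (mulVec_block_eq_zero hc).1) (by omega) (by omega),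
      Finset.mem_map_of_mem _ (hxA (Finset.mem_singleton_self x))⟩
  · refine ⟨Finset.univ.map ⟨fun x => Sum.inr (x, b), fun x y hxy => by simpa using hxy⟩,
      isRepairSet_map hP₂ _ _ (fun c hc => (mulVec_block_eq_zero hc).2 b) (by simp) ?_,
      Finset.mem_map_of_mem _ (Finset.mem_univ x)⟩
    rw [Finset.card_univ, Fintype.card_fin]
    omega

end Construction

/-! ### Optimality. -/

/-- As `0 < v < r`, the ceiling is `u + 1`, and its last `δ - 1` cancels. -/
theorem distanceBound_eq {n k u r v δ m : ℕ} (hk : k = u * r + v) (hv : 0 < v) (hvr : v < r) :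
    distanceBound n k r δ m = (n : ℤ) - k + 1 - u * ((δ : ℤ) - 1) - m := by
  have hr : (0 : ℚ) < r := by exact_mod_cast (by omega : 0 < r)
  have h1 : ⌈(k : ℚ) / r⌉ = (u : ℤ) + 1 := by
    rw [Int.ceil_eq_iff, hk]
    push_cast
    have hv' : (0 : ℚ) < v := by exact_mod_cast hv
    have hvr' : (v : ℚ) ≤ r := by exact_mod_cast hvr.le
    constructor
    · rw [lt_div_iff₀ hr]; linarith
    · rw [div_le_iff₀ hr]; linarith
  rw [distanceBound, h1]
  ring

/-- The upper bound on the minimum distance of a code with `(r, δ)_a`-locality. -/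
theorem minDist_le_distanceBound {ι K : Type*} [Fintype ι] [Field K] {C : Submodule K (ι → K)}
    {n k w u r v δ m d : ℕ} (hn : n = w * (r + δ - 1) + m) (hk : k = u * r + v) (hv : 0 < v)
    (hmδ : m ≤ δ - 1) (hvr : v < r) (hrv : r / 2 < v) (hu : 2 * r + δ - 1 ≤ u)
    (hC : IsLinearCodeWithParams C n k d) (hloc : HasAllSymbolLocality C r δ) :
    (d : ℤ) ≤ distanceBound n k r δ m := by
  classical
  obtain ⟨-, -, hδ, hloc⟩ := hloc
  rw [Nat.add_sub_assoc (by omega)] at hn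
  have h1 := minDist_add_le_of_locality (u := u) (v := v) (d := d) (by omega) hC.1 hn hloc hv
    hvr.le (fun c hc hc0 => hC.le_hammingNorm hc hc0) hmδ (hC.2.1.trans hk) (by omega) (by omega)
  rw [← hk] at h1
  rw [distanceBound_eq hk hv hvr]
  zify at h1
  rw [Nat.cast_sub (by omega)] at h1
  push_cast at h1
  linarith

theorem theorem4 {F L : Type*} [Field F] [Fintype F] [Field L] [Finite L] [Algebra F L]
    (n k w u r v δ m h : ℕ)
    (hn : n = w * (r + δ - 1) + m) (hk : k = u * r + v)
    (hh : (h : ℤ) = n - k - m - w * ((δ : ℤ) - 1))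
    (hv : 0 < v) (hm : 0 < m) (hmδ : m ≤ δ - 1)
    (hvr : v < r) (hrv : r / 2 < v) (hu : 2 * r + δ - 1 ≤ u)
    (P₁ : Matrix (Fin (m + δ - 1)) (Fin (m + r + δ - 1)) F)
    (hP₁ : IsLinearCodeWithParams (parityCheckCode P₁) (m + r + δ - 1) r (m + δ))
    (P₂ : Matrix (Fin (δ - 1)) (Fin (r + δ - 1)) F)
    (hP₂ : IsLinearCodeWithParams (parityCheckCode P₂) (r + δ - 1) r δ)
    (α : BlockCoord w r δ m → L) (hα : Function.Injective α)
    (hS : IsWiseIndependent F (Set.range α) (h + (w + 1 - u) * (δ - 1))) :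
    IsLinearCodeWithParams (parityCheckCode (blockParityCheck h P₁ P₂ α))
        n k (h + (w - u) * (δ - 1) + 1) ∧
      HasAllSymbolLocality (parityCheckCode (blockParityCheck h P₁ P₂ α)) r δ ∧
      ((h + (w - u) * (δ - 1) + 1 : ℕ) : ℤ) = distanceBound n k r δ m ∧
      ∀ (K : Type*) [Field K] [Finite K] (C : Submodule K (Fin n → K)) (d : ℕ),
        IsLinearCodeWithParams C n k d → HasAllSymbolLocality C r δ →
          (d : ℤ) ≤ distanceBound n k r δ m := by
  have hδ : 2 ≤ δ := by omega
  have hhN : h + k = w * r := by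
    rw [hn, Nat.add_sub_assoc (by omega)] at hh
    zify
    push_cast [Nat.cast_sub (show 1 ≤ δ by omega)] at hh
    linarith
  have huw : u < w := by
    by_contra! hle
    have := Nat.mul_le_mul_right r hle
    omega
  -- Here `h = (w - u) * r - v` with `v < r`.
  have hN : (w - u - 1) * r ≤ h := by
    obtain ⟨t, rfl⟩ := Nat.exists_eq_add_of_lt huw
    have e1 : u + t + 1 - u - 1 = t := by omega
    rw [hk, add_one_mul, add_mul] at hhN
    rw [e1]
    omega
  have ht : h + (w - u) * (δ - 1) ≤ h + (w + 1 - u) * (δ - 1) :=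
    Nat.add_le_add_left (Nat.mul_le_mul_right _ (by omega)) _
  have hlow : ∀ (T : Finset (BlockCoord w r δ m)) (c : BlockCoord w r δ m → L),
      c ∈ parityCheckCode (blockParityCheck h P₁ P₂ α) → T.card ≤ h + (w - u) * (δ - 1) →
      (∀ i ∉ T, c i = 0) → c = 0 := fun T c hc hT hcT =>
    eq_zero_of_mem_blockParityCheck hm hδ hP₁ hP₂ hα hS ht hN hT hc hcT
  have hdim : Module.finrank L (parityCheckCode (blockParityCheck h P₁ P₂ α)) = k := by
    refine le_antisymm ?_ (le_finrank_blockParityCheck (by omega) (by omega) hhN P₁ P₂ α)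
    rw [hk] at hhN ⊢
    exact finrank_blockParityCheck_le hm hδ hhN (by omega) hv hvr.le hP₁ hP₂ hlow
  have hru : r ≤ k := by
    have : 1 * r ≤ u * r := Nat.mul_le_mul_right r (by omega)
    omega
  have hloc : HasAllSymbolLocality (parityCheckCode (blockParityCheck h P₁ P₂ α)) r δ :=
    hasAllSymbolLocality_blockParityCheck hm hδ (by omega) hP₁ hP₂ (hdim ▸ hru)
  have hd : ((h + (w - u) * (δ - 1) + 1 : ℕ) : ℤ) = distanceBound n k r δ m := by
    rw [distanceBound_eq hk hv hvr]
    push_cast [Nat.cast_sub huw.le, Nat.cast_sub (show 1 ≤ δ by omega)]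
    rw [hh]
    ring
  -- No word of minimum weight is exhibited: the locality bound for this very code caps its distance
  -- at the value reached by `hlow`.
  refine ⟨isLinearCodeWithParams_of_bounds ?_ hdim (by omega)
    (fun D c hc hD hcD => hlow D c hc (by omega) hcD) fun d' hd' => ?_, hloc, hd,
    fun K _ _ C d hC hC' => minDist_le_distanceBound hn hk hv hmδ hvr hrv hu hC hC'⟩
  · rw [card_blockCoord (by omega) (by omega), hn, Nat.add_sub_assoc (by omega)]
  · have := minDist_le_distanceBound hn hk hv hmδ hvr hrv hu hd' hloc
    rw [← hd] at this
    exact_mod_cast this
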